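/- Let $X_0$ be a complete Hausdorff locally convex space over $\mathbb{K}\in\{\mathbb{R},\mathbb{C}\}$ whose topology $\tau_0$ is given by a family of seminorms $(p_{\gamma,0})_{\gamma\in\Gamma}$. Let $T_0=(T_0(t))_{t\ge 0}$ be a strongly continuous and exponentially equicontinuous semigroup on $X_0$, i.e. a family of continuous linear operators with $T_0(0)=I$, $T_0(s+t)=T_0(s)T_0(t)$ for $s,t\geq 0$, with continuous orbits $t\mapsto T_0(t)x$, and such that $\{e^{\omega t}T_0(t) : t\ge 0\}$ is equicontinuous for some $\omega\in\mathbb{R}$. Let $A_0x=\lim_{t\searrow 0}\frac{T_0(t)x-x}{t}$ be its generator, with domain $D(A_0)$ the set of all $x\in X_0$ for which this limit exists, and assume that $A_0\colon D(A_0)\to X_0$ is bijective and that $A_0^{-1}\colon X_0\to X_0$ is continuous. Define spaces $(X_n,\tau_n)$, operators $T_n=(T_n(t))_{t\ge0}$ and their generators $(A_n,D(A_n))$ for $n\in\mathbb{Z}$ recursively. For $n\ge 1$ let $X_n=D(A_{n-1})$, with $\tau_n$ given by the seminorms $p_{\gamma,n}(x)=p_{\gamma,n-1}(A_{n-1}x)$,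 $\gamma\in\Gamma$, and let $T_n(t)$ be the restriction of $T_{n-1}(t)$ to $X_n$. For $n\le -1$ let $(X_n,\tau_n)$ be the completion of $(X_{n+1},\check\tau_n)$, where $\check\tau_n$ is given by the seminorms $\check p_{\gamma,n}(x)=p_{\gamma,n+1}(A_{n+1}^{-1}x)$, $\gamma\in\Gamma$. Let $p_{\gamma,n}$ be the continuous extension of $\check p_{\gamma,n}$ to $X_n$, and let $T_n(t)$ be the continuous extension of $T_{n+1}(t)$ to $X_n$. In both cases $A_n$ denotes the generator of $T_n$. Then all these objects are well-defined, the $(X_n,\tau_n)$ are complete Hausdorff locally convex spaces, and the following holds. (i) For every $n\in\mathbb{Z}$: $X_n\subseteq X_{n-1}$, $X_n$ is dense in $(X_{n-1},\tau_{n-1})$, and the inclusion $(X_n,\tau_n)\hookrightarrow(X_{n-1},\tau_{n-1})$ is continuous. (ii) For $n\le 0$ the topology $\tau_n$ is given by the seminorms $p_{\gamma,n-1}(A_{n-1}(\cdot))$, $\gamma\in\Gamma$. (iii) For $n\ge 0$ the space $(X_n,\tau_n)$ is the completion of $(X_{n+1},\check\tau_n)$, where $\check\tau_n$ is given by the seminorms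 $\check p_{\gamma,n}(\cdot)=p_{\gamma,n+1}(A_{n+1}^{-1}(\cdot))$, $\gamma\in\Gamma$. For every $n\in\mathbb{Z}$ the family $T_n$ is a strongly continuous and exponentially equicontinuous semigroup on $(X_n,\tau_n)$, and moreover: (iv) For every $n\in\mathbb{Z}$ and $t\ge0$, $T_n(t)\colon X_n\to X_n$ is the restriction of $T_{n-1}(t)\colon X_{n-1}\to X_{n-1}$ and the unique continuous extension of $T_{n+1}(t)\colon X_{n+1}\to X_{n+1}$. (v) For every $n\in\mathbb{Z}$: $D(A_n)=X_{n+1}$, and $A_n\colon(X_{n+1},\tau_{n+1})\to(X_n,\tau_n)$ is an isomorphism (linear homeomorphism). It is the restriction of $A_{n-1}\colon X_n\to X_{n-1}$ and the unique continuous extension of $A_{n+1}\colon X_{n+2}\to X_{n+1}$. -/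

import Mathlib

open Filter Topology UniformSpace
open scoped NNReal

noncomputable section

namespace SobolevTower

universe u v w

section Semigroups

variable {𝕜 : Type v} [RCLike 𝕜] {E : Type u} [AddCommGroup E] [Module 𝕜 E]
  [UniformSpace E] [IsUniformAddGroup E] [ContinuousSMul 𝕜 E]

/-- Strongly continuous, exponentially equicontinuous semigroups of continuous linear operators:
`T 0 = I`, `T (s + t) = T s T t`, all orbits `t ↦ T t x` are continuous on `[0, ∞)`, and for some
real `ω` the set `{exp (ω t) T t : t ≥ 0}` is equicontinuous. -/
structure IsExpEquicontinuousSemigroup (T : ℝ≥0 → E →L[𝕜] E) : Prop where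
  map_zero : T 0 = ContinuousLinearMap.id 𝕜 E
  map_add : ∀ s t : ℝ≥0, T (s + t) = (T s).comp (T t)
  continuous_orbit : ∀ x : E, Continuous fun t : ℝ≥0 => T t x
  exp_equicontinuous : ∃ ω : ℝ, Equicontinuous
    (fun (t : ℝ≥0) (x : E) => ((Real.exp (ω * (t : ℝ)) : ℝ) : 𝕜) • T t x)

/-- The graph of the generator: all pairs `(x, y)` such that
`(T t x - x) / t` converges to `y` as `t ↘ 0`. -/
def generatorGraph (T : ℝ≥0 → E →L[𝕜] E) : Submodule 𝕜 (E × E) where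
  carrier := {z | Tendsto (fun t : ℝ≥0 => (((t : ℝ) : 𝕜)⁻¹) • (T t z.1 - z.1))
    (𝓝[>] (0 : ℝ≥0)) (𝓝 z.2)}
  zero_mem' := by
    simpa using tendsto_const_nhds (x := (0 : E)) (f := 𝓝[>] (0 : ℝ≥0))
  add_mem' := by
    intro a b ha hb
    refine (Tendsto.add ha hb).congr fun t => ?_
    simp only [Prod.fst_add, map_add, ← smul_add]
    congr 1
    abel
  smul_mem' := by
    intro c a ha
    refine (Tendsto.const_smul ha c).congr fun t => ?_
    simp only [Prod.smul_fst, map_smul, ← smul_sub]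
    exact smul_comm _ _ _

/-- The generator `(A, D(A))` of a semigroup, as a partially defined linear operator. Its domain
is the set of all `x` for which the limit of `(T t x - x) / t` as `t ↘ 0` exists, and `A x` is
that limit (limits are unique in the Hausdorff spaces for which this is used). -/
def generator (T : ℝ≥0 → E →L[𝕜] E) : E →ₗ.[𝕜] E := (generatorGraph T).toLinearPMap

end Semigroups

open Classical in
/-- The inverse `A⁻¹ : E → E` of a bijective operator `A : D(A) → E`, as a map into `E`
(by convention `0` if `A` is not bijective). -/
def inverseMap {𝕜 : Type v} [RCLike 𝕜] {E : Type u} [AddCommGroup E] [Module 𝕜 E]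
    (A : E →ₗ.[𝕜] E) : E →ₗ[𝕜] E :=
  if h : Function.Bijective A.toFun then
    A.domain.subtype ∘ₗ (LinearEquiv.ofBijective A.toFun h).symm.toLinearMap
  else 0

section Families

variable {𝕜 : Type v} [RCLike 𝕜] {Γ : Type w} {E : Type u} [AddCommGroup E] [Module 𝕜 E]

/-- The vector space `E`, equipped with the topology (and uniformity) given by the family of
seminorms `p`. -/
def Topologized (_p : SeminormFamily 𝕜 E Γ) : Type u := E

variable (p : SeminormFamily 𝕜 E Γ)

instance : AddCommGroup (Topologized p) := inferInstanceAs (AddCommGroup E)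

instance : Module 𝕜 (Topologized p) := inferInstanceAs (Module 𝕜 E)

instance : TopologicalSpace (Topologized p) := p.moduleFilterBasis.topology

/-- The family `p`, regarded on `Topologized p`. -/
def topologizedFamily : SeminormFamily 𝕜 (Topologized p) Γ := p

theorem withSeminorms_topologized : WithSeminorms (topologizedFamily p) := ⟨rfl⟩

instance : IsTopologicalAddGroup (Topologized p) :=
  (withSeminorms_topologized p).topologicalAddGroup

instance : UniformSpace (Topologized p) := IsTopologicalAddGroup.rightUniformSpace (Topologized p)

instance : IsUniformAddGroup (Topologized p) := isUniformAddGroup_of_addCommGroup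

instance : ContinuousSMul 𝕜 (Topologized p) := (withSeminorms_topologized p).continuousSMul

instance : UniformContinuousConstSMul 𝕜 (Topologized p) :=
  uniformContinuousConstSMul_of_continuousConstSMul 𝕜 (Topologized p)

theorem uniformContinuous_topologizedFamily (i : Γ) :
    UniformContinuous (topologizedFamily p i) :=
  Seminorm.uniformContinuous_of_continuousAt_zero
    ((withSeminorms_topologized p).continuous_seminorm i).continuousAt

/-- The continuous extensions of the seminorms `p` to the completion of `Topologized p`. -/
def completionFamily : SeminormFamily 𝕜 (Completion (Topologized p)) Γ := fun i =>
  Seminorm.of (Completion.extension (topologizedFamily p i))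
    (fun x y => by
      refine Completion.induction_on₂ x y
        (isClosed_le (by fun_prop) (by fun_prop)) fun a b => ?_
      rw [← Completion.coe_add]
      simp only [Completion.extension_coe (uniformContinuous_topologizedFamily p i)]
      exact map_add_le_add _ a b)
    (fun c x => by
      refine Completion.induction_on x
        (isClosed_eq (Completion.continuous_extension.comp (continuous_const_smul c))
          (by fun_prop)) fun a => ?_
      rw [← Completion.coe_smul]
      simp only [Completion.extension_coe (uniformContinuous_topologizedFamily p i)]
      exact map_smul_eq_mul _ c a)

theorem completionFamily_coe (i : Γ) (x : Topologized p) :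
    completionFamily p i (x : Completion (Topologized p)) = topologizedFamily p i x :=
  Completion.extension_coe (uniformContinuous_topologizedFamily p i) x

theorem continuous_completionFamily (i : Γ) : Continuous (completionFamily p i) :=
  Completion.continuous_extension (f := topologizedFamily p i)

/-- The topology of the completion is given by the extended seminorms. -/
theorem withSeminorms_completion : WithSeminorms (completionFamily p) := by
  rw [SeminormFamily.withSeminorms_iff_nhds_eq_iInf]
  apply le_antisymm
  · refine le_iInf fun i => ?_
    rw [← tendsto_iff_comap]
    simpa using (continuous_completionFamily p i).tendsto 0
  · intro U hU
    have hb := (withSeminorms_topologized p).hasBasis_zero_ball.hasBasis_of_isDenseInducing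
      (Completion.isDenseInducing_coe (α := Topologized p))
    rw [Completion.coe_zero, hb.mem_iff] at *
    obtain ⟨⟨s, r⟩, hr, hsub⟩ := hU
    have hV : (⋂ i ∈ s, {x | completionFamily p i x < r}) ∈
        ⨅ i, comap (completionFamily p i) (𝓝 0) := by
      rw [biInter_finset_mem]
      intro i _
      refine mem_iInf_of_mem i ⟨Set.Iio r, Iio_mem_nhds hr, fun x hx => hx⟩
    refine mem_of_superset hV fun x hx => hsub ?_
    rw [mem_closure_iff]
    intro W hW hxW
    have hO : IsOpen (W ∩ ⋂ i ∈ s, {x | completionFamily p i x < r}) :=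
      hW.inter (isOpen_biInter_finset fun i _ =>
        isOpen_lt (continuous_completionFamily p i) continuous_const)
    obtain ⟨a, ha⟩ := Completion.denseRange_coe.exists_mem_open hO ⟨x, hxW, hx⟩
    refine ⟨_, ha.1, a, ?_, rfl⟩
    rw [Seminorm.mem_ball_zero]
    refine Seminorm.finset_sup_apply_lt hr fun i hi => ?_
    rw [← completionFamily_coe]
    have := ha.2
    simp only [Set.mem_iInter, Set.mem_ofPred_eq] at this
    exact this i hi

end Families

/-- A locally convex space, with a family of seminorms that gives its topology, together with a
family of continuous linear operators indexed by the times `t ≥ 0`. -/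
structure Level (𝕜 : Type v) [RCLike 𝕜] (Γ : Type w) where
  carrier : Type u
  [addCommGroup : AddCommGroup carrier]
  [module : Module 𝕜 carrier]
  [uniformSpace : UniformSpace carrier]
  [isUniformAddGroup : IsUniformAddGroup carrier]
  [continuousSMul : ContinuousSMul 𝕜 carrier]
  p : SeminormFamily 𝕜 carrier Γ
  withSeminorms : WithSeminorms p
  T : ℝ≥0 → carrier →L[𝕜] carrier

attribute [instance] Level.addCommGroup Level.module Level.uniformSpace
  Level.isUniformAddGroup Level.continuousSMul

namespace Level

variable {𝕜 : Type v} [RCLike 𝕜] {Γ : Type w} (S : Level.{u} 𝕜 Γ)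

instance : CoeSort (Level.{u} 𝕜 Γ) (Type u) := ⟨Level.carrier⟩

/-- The generator of the semigroup. -/
def gen : S →ₗ.[𝕜] S := generator S.T

/-- The seminorms `x ↦ p (A x)` on the domain `D(A)` of the generator `A`. -/
def domainFamily : SeminormFamily 𝕜 S.gen.domain Γ := fun i => (S.p i).comp S.gen.toFun

/-- The seminorms `x ↦ p (A⁻¹ x)`, for the generator `A`. -/
def checkFamily : SeminormFamily 𝕜 S Γ := fun i => (S.p i).comp (inverseMap S.gen)

open Classical in
/-- The next smaller space: the domain `D(A)` of the generator with the topology given by the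
seminorms `x ↦ p (A x)`, and the restrictions of the operators `T t` to `D(A)`
(by convention `0` if there is no continuous restriction). -/
def up : Level.{u} 𝕜 Γ where
  carrier := Topologized S.domainFamily
  p := topologizedFamily S.domainFamily
  withSeminorms := withSeminorms_topologized S.domainFamily
  T := fun t =>
    if h : ∃ R : Topologized S.domainFamily →L[𝕜] Topologized S.domainFamily,
        ∀ x : S.gen.domain, S.gen.domain.subtype (R x) = S.T t x
    then h.choose else 0

/-- The inclusion of `D(A)` into the space. -/
def upIncl : S.up →ₗ[𝕜] S := S.gen.domain.subtype

open Classical in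
/-- The next larger space: the completion of the space for the topology given by the
seminorms `x ↦ p (A⁻¹ x)`, and the continuous extensions of the operators `T t` to the completion
(by convention `0` if there is no continuous extension). -/
def down : Level.{u} 𝕜 Γ where
  carrier := Completion (Topologized S.checkFamily)
  continuousSMul := (withSeminorms_completion S.checkFamily).continuousSMul
  p := completionFamily S.checkFamily
  withSeminorms := withSeminorms_completion S.checkFamily
  T := fun t =>
    if h : ∃ R : Completion (Topologized S.checkFamily) →L[𝕜]
          Completion (Topologized S.checkFamily),
        ∀ x : Topologized S.checkFamily,
          R (x : Completion (Topologized S.checkFamily)) =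
            ((show Topologized S.checkFamily from S.T t x) :
              Completion (Topologized S.checkFamily))
    then h.choose else 0

/-- The canonical map of the space into the completion. -/
def downIncl : S →ₗ[𝕜] S.down where
  toFun := fun x => ((show Topologized S.checkFamily from x) :
    Completion (Topologized S.checkFamily))
  map_add' := fun x y => Completion.coe_add (α := Topologized S.checkFamily) x y
  map_smul' := fun c x => Completion.coe_smul (X := Topologized S.checkFamily) c x

/-- Iterated domains: `X_0, X_1, X_2, …`. -/
def upper : ℕ → Level.{u} 𝕜 Γ
  | 0 => S
  | n + 1 => (upper n).up

/-- Iterated completions: `X_0, X_{-1}, X_{-2}, …`. -/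
def lower : ℕ → Level.{u} 𝕜 Γ
  | 0 => S
  | n + 1 => (lower n).down

/-- The Sobolev tower `(X_n, τ_n)` with the operators `T_n t`, for all integers `n`. -/
def tower : ℤ → Level.{u} 𝕜 Γ
  | Int.ofNat n => S.upper n
  | Int.negSucc n => S.lower (n + 1)

/-- The inclusion of `X_{n+1}` into `X_n`. -/
def incl : (n : ℤ) → (S.tower (n + 1) →ₗ[𝕜] S.tower n)
  | Int.ofNat n => (S.upper n).upIncl
  | Int.negSucc 0 => (S.lower 0).downIncl
  | Int.negSucc (n + 1) => (S.lower (n + 1)).downIncl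

end Level

/-- `F` is a completion of `E`, with the canonical map `j`: `F` is complete and Hausdorff, and `j`
induces the uniformity of `E` and has dense range. -/
structure IsCompletionMap {E : Type u} {F : Type u} [UniformSpace E] [UniformSpace F]
    (j : E → F) : Prop where
  complete : CompleteSpace F
  hausdorff : T2Space F
  isUniformInducing : IsUniformInducing j
  denseRange : DenseRange j

end SobolevTower

end

/-! Everything reduces to one step of the tower. Going up, `D(A)` with the seminorms `p ∘ A` makes
`A` a linear homeomorphism onto the space by construction. Going down, `A⁻¹` preserves seminorms
from the space with `p ∘ A⁻¹` into the space with `p`, and its range `D(A)` is dense. Hence the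
original space, along `A⁻¹`, is itself a completion (`checkCompletion`), and uniqueness of
completions extends `A⁻¹` to a linear homeomorphism of the larger space onto the original one.

Both constructions give an `IsStep`: a map `ι : U → L` and a homeomorphism `A : U ≃ L` that
intertwines the semigroups and is the generator on `L` along `ι`. As `A` is a conjugation,
completeness and the semigroup and generator hypotheses transfer between `U` and `L`
(`Admissible.of_equiv`), so the recursion continues both ways. All relations between neighbours
follow from `IsStep` alone: `ι` is the inverse generator of `L` after `A`, hence continuous, and it
has dense range because `A x` is a limit of difference quotients lying in the domain. -/

noncomputable section

namespace SobolevTower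

universe u v w

/-! ### Generators, handled through their graphs -/

section Generator

variable {𝕜 : Type v} [RCLike 𝕜] {E F : Type u} [AddCommGroup E] [Module 𝕜 E]
  [UniformSpace E] [IsUniformAddGroup E]
  [AddCommGroup F] [Module 𝕜 F] [UniformSpace F] [IsUniformAddGroup F]

/-- Transport of a semigroup along a linear homeomorphism. -/
theorem IsExpEquicontinuousSemigroup.of_equiv {T : ℝ≥0 → E →L[𝕜] E} {T' : ℝ≥0 → F →L[𝕜] F}
    (hT : IsExpEquicontinuousSemigroup T) (e : F ≃L[𝕜] E) (h : ∀ t x, e (T' t x) = T t (e x)) :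
    IsExpEquicontinuousSemigroup T' where
  map_zero := by
    ext x
    apply e.injective
    simp [h, hT.map_zero]
  map_add s t := by
    ext x
    apply e.injective
    simp [h, hT.map_add]
  continuous_orbit x := by
    have : (fun t => T' t x) = fun t => e.symm (T t (e x)) := by
      ext t
      rw [← h, e.symm_apply_apply]
    rw [this]
    exact e.symm.continuous.comp (hT.continuous_orbit (e x))
  exp_equicontinuous := by
    obtain ⟨ω, hω⟩ := hT.exp_equicontinuous
    refine ⟨ω, ?_⟩
    have he : IsUniformInducing e := e.isUniformEmbedding.isUniformInducing
    rw [he.equicontinuous_iff]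
    have : ((fun f : F → F => e ∘ f) ∘
        (fun (t : ℝ≥0) (x : F) => ((Real.exp (ω * (t : ℝ)) : ℝ) : 𝕜) • T' t x)) =
        fun (t : ℝ≥0) => (fun x => ((Real.exp (ω * (t : ℝ)) : ℝ) : 𝕜) • T t x) ∘ e := by
      ext t x
      simp [h]
    rw [this]
    intro x U hU
    exact e.continuous.continuousAt.eventually (hω (e x) U hU)

variable [ContinuousSMul 𝕜 E] [ContinuousSMul 𝕜 F]

theorem mem_generatorGraph {T : ℝ≥0 → E →L[𝕜] E} {x y : E} :
    (x, y) ∈ generatorGraph T ↔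
      Tendsto (fun t : ℝ≥0 => (((t : ℝ) : 𝕜)⁻¹) • (T t x - x)) (𝓝[>] (0 : ℝ≥0)) (𝓝 y) :=
  Iff.rfl

theorem generatorGraph_unique [T2Space E] {T : ℝ≥0 → E →L[𝕜] E} {x y z : E}
    (hy : (x, y) ∈ generatorGraph T) (hz : (x, z) ∈ generatorGraph T) : y = z :=
  tendsto_nhds_unique (mem_generatorGraph.1 hy) (mem_generatorGraph.1 hz)

/-- `Submodule.toLinearPMap` recovers the submodule only if no nonzero vector lies over `0`;
uniqueness of limits ensures this. -/
theorem generator_graph [T2Space E] (T : ℝ≥0 → E →L[𝕜] E) :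
    (generator T).graph = generatorGraph T := by
  refine Submodule.toLinearPMap_graph_eq _ fun x hx h0 => ?_
  obtain ⟨a, b⟩ := x
  obtain rfl : a = 0 := h0
  exact generatorGraph_unique hx (generatorGraph T).zero_mem

theorem generator_mem_generatorGraph [T2Space E] (T : ℝ≥0 → E →L[𝕜] E)
    (x : (generator T).domain) : ((x : E), (generator T).toFun x) ∈ generatorGraph T := by
  rw [← generator_graph]
  exact LinearPMap.mem_graph _ x

theorem exists_generator_eq [T2Space E] {T : ℝ≥0 → E →L[𝕜] E} {x y : E}
    (h : (x, y) ∈ generatorGraph T) :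
    ∃ hx : x ∈ (generator T).domain, (generator T).toFun ⟨x, hx⟩ = y := by
  rw [← generator_graph, LinearPMap.mem_graph_iff] at h
  obtain ⟨z, rfl, hz⟩ := h
  exact ⟨z.2, hz⟩

theorem bijective_generator_iff [T2Space E] (T : ℝ≥0 → E →L[𝕜] E) :
    Function.Bijective (generator T).toFun ↔ ∀ y, ∃! x, (x, y) ∈ generatorGraph T := by
  rw [Function.bijective_iff_existsUnique]
  refine forall_congr' fun y => ⟨?_, ?_⟩
  · rintro ⟨x, rfl, hx⟩
    refine ⟨x, generator_mem_generatorGraph T x, fun z hz => ?_⟩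
    obtain ⟨hz', h⟩ := exists_generator_eq hz
    exact congrArg Subtype.val (hx ⟨z, hz'⟩ h)
  · rintro ⟨x, hx, h⟩
    obtain ⟨hx', hxy⟩ := exists_generator_eq hx
    refine ⟨⟨x, hx'⟩, hxy, fun z hz => Subtype.ext (h z ?_)⟩
    rw [← hz]
    exact generator_mem_generatorGraph T z

theorem inverseMap_mem_generatorGraph [T2Space E] {T : ℝ≥0 → E →L[𝕜] E}
    (h : Function.Bijective (generator T).toFun) (y : E) :
    (inverseMap (generator T) y, y) ∈ generatorGraph T := by
  have := generator_mem_generatorGraph T ((LinearEquiv.ofBijective _ h).symm y)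
  rw [show (generator T).toFun ((LinearEquiv.ofBijective _ h).symm y) = y from
    (LinearEquiv.ofBijective _ h).apply_symm_apply y] at this
  rw [inverseMap, dif_pos h]
  exact this

theorem inverseMap_eq [T2Space E] {T : ℝ≥0 → E →L[𝕜] E}
    (h : Function.Bijective (generator T).toFun) {x y : E} (hxy : (x, y) ∈ generatorGraph T) :
    inverseMap (generator T) y = x :=
  ((bijective_generator_iff T).1 h y).unique (inverseMap_mem_generatorGraph h y) hxy

/-- Continuous linear maps that intertwine two semigroups map one generator into the other. -/
theorem map_mem_generatorGraph {T : ℝ≥0 → E →L[𝕜] E} {T' : ℝ≥0 → F →L[𝕜] F} {f : E →ₗ[𝕜] F}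
    (hf : Continuous f) (h : ∀ t x, f (T t x) = T' t (f x)) {x y : E}
    (hxy : (x, y) ∈ generatorGraph T) : (f x, f y) ∈ generatorGraph T' := by
  refine (((hf.tendsto y).comp (mem_generatorGraph.1 hxy))).congr fun t => ?_
  simp [h]

/-- The operators `T t` and `T s` commute, so `T t` intertwines the semigroup with itself. -/
theorem IsExpEquicontinuousSemigroup.apply_mem_generatorGraph {T : ℝ≥0 → E →L[𝕜] E}
    (hT : IsExpEquicontinuousSemigroup T) (t : ℝ≥0) {x y : E}
    (hxy : (x, y) ∈ generatorGraph T) : (T t x, T t y) ∈ generatorGraph T := by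
  refine map_mem_generatorGraph (f := (T t : E →ₗ[𝕜] E)) (T t).continuous (fun s x => ?_) hxy
  have h1 := hT.map_add s t
  rw [add_comm, hT.map_add t s] at h1
  exact congrArg (fun f : E →L[𝕜] E => f x) h1

/-- A subset of the domain of the generator that contains all `(T t x - x) / t` and is mapped
onto the space is dense, since `A x` is the limit of these elements. -/
theorem denseRange_of_mem_generatorGraph {T : ℝ≥0 → E →L[𝕜] E} {V : Type*}
    {f : V → E} (hV : ∀ t : ℝ≥0, ∀ v, ∃ w, f w = (((t : ℝ) : 𝕜)⁻¹) • (T t (f v) - f v))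
    (h : ∀ y, ∃ v, (f v, y) ∈ generatorGraph T) : DenseRange f := by
  intro y
  obtain ⟨v, hv⟩ := h y
  exact mem_closure_of_tendsto (mem_generatorGraph.1 hv) (Eventually.of_forall fun t => hV t v)

end Generator

/-! ### Pullbacks of seminorm topologies -/

section Topologized

variable {𝕜 : Type v} [RCLike 𝕜] {Γ : Type w} {E F : Type u} [AddCommGroup E] [Module 𝕜 E]
  [AddCommGroup F] [Module 𝕜 F]

theorem isInducing_topologized [UniformSpace F] {q : SeminormFamily 𝕜 F Γ}
    (hq : WithSeminorms q) (f : E →ₗ[𝕜] F) :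
    IsInducing (fun x : Topologized (fun i => (q i).comp f : SeminormFamily 𝕜 E Γ) => f x) := by
  let _ : TopologicalSpace E := TopologicalSpace.induced f inferInstance
  exact ⟨(LinearMap.withSeminorms_induced hq f).topology_eq_withSeminorms.symm⟩

theorem isUniformInducing_topologized [UniformSpace F] [IsUniformAddGroup F]
    {q : SeminormFamily 𝕜 F Γ} (hq : WithSeminorms q) (f : E →ₗ[𝕜] F) :
    IsUniformInducing
      (fun x : Topologized (fun i => (q i).comp f : SeminormFamily 𝕜 E Γ) => f x) :=
  AddMonoidHom.isUniformInducing_of_isInducing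
    (f := (show Topologized (fun i => (q i).comp f : SeminormFamily 𝕜 E Γ) →+ F from
      f.toAddMonoidHom)) (isInducing_topologized hq f)

end Topologized

end SobolevTower

end

noncomputable section

namespace SobolevTower

universe u v w

/-! ### Consequences of a single step of the tower -/

namespace Level

variable {𝕜 : Type v} [RCLike 𝕜] {Γ : Type w}

/-- The standing assumptions under which the next smaller and the next larger space of the tower
are formed. -/
structure Admissible (S : Level.{u} 𝕜 Γ) : Prop where
  complete : CompleteSpace S
  hausdorff : T2Space S
  semigroup : IsExpEquicontinuousSemigroup S.T
  bijective : Function.Bijective S.gen.toFun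
  continuous_inverse : Continuous (inverseMap S.gen)

/-- The equivalence conjugates the generators. The seminorms of the two spaces need not correspond:
only the topologies and semigroups enter. -/
theorem Admissible.of_equiv {S U : Level.{u} 𝕜 Γ} (hS : S.Admissible) (e : U ≃L[𝕜] S)
    (h : ∀ t x, e (U.T t x) = S.T t (e x)) : U.Admissible := by
  have := hS.complete
  have := hS.hausdorff
  have hT2 : T2Space U := e.toHomeomorph.isEmbedding.t2Space
  have hmem : ∀ x y : U, (x, y) ∈ generatorGraph U.T ↔ (e x, e y) ∈ generatorGraph S.T := by
    refine fun x y => ⟨map_mem_generatorGraph (f := e.toLinearEquiv.toLinearMap) e.continuous h,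
      fun hxy => ?_⟩
    have := map_mem_generatorGraph (f := e.symm.toLinearEquiv.toLinearMap) (T' := U.T)
      e.symm.continuous (fun t x => e.injective (by simp [h])) hxy
    simpa using this
  have hbij : Function.Bijective U.gen.toFun := by
    refine (bijective_generator_iff U.T).2 fun y => ?_
    obtain ⟨x, hx, hu⟩ := (bijective_generator_iff S.T).1 hS.bijective (e y)
    refine ⟨e.symm x, (hmem _ _).2 (by simpa using hx), fun z hz => ?_⟩
    rw [← hu (e z) ((hmem _ _).1 hz), e.symm_apply_apply]
  refine ⟨(completeSpace_congr (e := e.toEquiv) e.isUniformEmbedding).2 hS.complete, hT2,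
    hS.semigroup.of_equiv e h, hbij, ?_⟩
  have : (inverseMap U.gen : U → U) = fun y => e.symm (inverseMap S.gen (e y)) := by
    ext y
    refine inverseMap_eq hbij ((hmem _ _).2 ?_)
    rw [e.apply_symm_apply]
    exact inverseMap_mem_generatorGraph hS.bijective (e y)
  rw [this]
  exact e.symm.continuous.comp (hS.continuous_inverse.comp e.continuous)

/-- The linear homeomorphism `A` of `U` onto `L` intertwines the semigroups, and along `ι` it is
the generator of the semigroup on `L`. -/
structure IsStep {L U : Level.{u} 𝕜 Γ} (ι : U →ₗ[𝕜] L) (A : U ≃L[𝕜] L) : Prop where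
  map_T : ∀ t x, A (U.T t x) = L.T t (A x)
  mem_graph : ∀ x, (ι x, A x) ∈ generatorGraph L.T

namespace IsStep

variable {L U : Level.{u} 𝕜 Γ} {ι : U →ₗ[𝕜] L} {A : U ≃L[𝕜] L}

theorem inverseMap_apply (h : IsStep ι A) (hL : L.Admissible) (x : U) :
    inverseMap L.gen (A x) = ι x :=
  have := hL.hausdorff
  inverseMap_eq hL.bijective (h.mem_graph x)

theorem exists_eq_of_mem_graph (h : IsStep ι A) (hL : L.Admissible) {x y : L}
    (hxy : (x, y) ∈ generatorGraph L.T) : ι (A.symm y) = x := by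
  have := hL.hausdorff
  rw [← h.inverseMap_apply hL, A.apply_symm_apply]
  exact inverseMap_eq hL.bijective hxy

theorem continuous (h : IsStep ι A) (hL : L.Admissible) : Continuous ι := by
  have : (ι : U → L) = fun x => inverseMap L.gen (A x) :=
    funext fun x => (h.inverseMap_apply hL x).symm
  rw [this]
  exact hL.continuous_inverse.comp A.continuous

/-- Points with the same image under `ι` have the same generator value, and `A` is injective. -/
theorem injective (h : IsStep ι A) (hL : L.Admissible) : Function.Injective ι := by
  have := hL.hausdorff
  intro x y hxy
  have hx := h.mem_graph x
  rw [hxy] at hx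
  exact A.injective (generatorGraph_unique hx (h.mem_graph y))

/-- Both sides have the generator value `L.T t (A x)`, and the generator of `L` is injective. -/
theorem map_incl (h : IsStep ι A) (hL : L.Admissible) (t : ℝ≥0) (x : U) :
    ι (U.T t x) = L.T t (ι x) := by
  rw [← h.exists_eq_of_mem_graph hL (hL.semigroup.apply_mem_generatorGraph t (h.mem_graph x)),
    ← h.map_T, A.symm_apply_apply]

theorem denseRange (h : IsStep ι A) (hL : L.Admissible) : DenseRange ι := by
  refine denseRange_of_mem_generatorGraph (𝕜 := 𝕜) (T := L.T) (fun t v => ?_)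
    fun y => ⟨A.symm y, ?_⟩
  · exact ⟨(((t : ℝ) : 𝕜)⁻¹) • (U.T t v - v), by simp [h.map_incl hL]⟩
  · simpa using h.mem_graph (A.symm y)

theorem domain_eq (h : IsStep ι A) (hL : L.Admissible) :
    L.gen.domain = LinearMap.range ι := by
  have := hL.hausdorff
  ext x
  refine ⟨fun hx => ⟨_, h.exists_eq_of_mem_graph hL (generator_mem_generatorGraph L.T ⟨x, hx⟩)⟩,
    ?_⟩
  rintro ⟨z, rfl⟩
  exact (exists_generator_eq (h.mem_graph z)).1

theorem admissible (h : IsStep ι A) (hL : L.Admissible) : U.Admissible :=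
  hL.of_equiv A h.map_T

/-- The generator on the smaller space is a restriction of the one on the larger space. -/
theorem incl_apply (h : IsStep ι A) (hL : L.Admissible) {V : Level.{u} 𝕜 Γ} {κ : V →ₗ[𝕜] U}
    {B : V ≃L[𝕜] U} (hB : IsStep κ B) (x : V) : ι (B x) = A (κ x) :=
  have := hL.hausdorff
  generatorGraph_unique
    (map_mem_generatorGraph (h.continuous hL) (h.map_incl hL) (hB.mem_graph x))
    (h.mem_graph (κ x))

/-- If the seminorms of `U` are those of `L` composed with `A`, then `L` is the completion
of `U` for the seminorms composed with the inverse of the generator. -/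
theorem isCompletionMap (h : IsStep ι A) (hL : L.Admissible)
    (hp : ∀ i x, U.p i x = L.p i (A x)) :
    IsCompletionMap (fun x : Topologized U.checkFamily => ι x) := by
  have hU := h.admissible hL
  have := hU.hausdorff
  -- If `z` is the inverse generator of `U` at `x`, then applying `ι` to the pair `(z, x)` gives `A
  -- z = ι x`; hence the seminorm of `U` at `z` is that of `L` at `ι x`.
  have key : U.checkFamily = fun i => (L.p i).comp ι := by
    funext i
    ext x
    refine (hp i _).trans (congrArg (L.p i) ?_)
    have h1 := inverseMap_mem_generatorGraph hU.bijective x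
    have h2 := map_mem_generatorGraph (h.continuous hL) (h.map_incl hL) h1
    exact (A.symm_apply_eq.1 (h.injective hL (h.exists_eq_of_mem_graph hL h2))).symm
  refine ⟨hL.complete, hL.hausdorff, ?_, h.denseRange hL⟩
  rw [key]
  exact isUniformInducing_topologized L.withSeminorms ι

end IsStep

/-! ### The step to the domain of the generator -/

section Up

variable {S : Level.{u} 𝕜 Γ}

/-- The generator as a linear homeomorphism of its domain, with the seminorms `p (A x)`,
onto the space. -/
def upEquiv (h : Function.Bijective S.gen.toFun) : S.up ≃L[𝕜] S where
  toLinearEquiv := (LinearEquiv.ofBijective S.gen.toFun h : S.gen.domain ≃ₗ[𝕜] S)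
  continuous_toFun := (isInducing_topologized S.withSeminorms S.gen.toFun).continuous
  continuous_invFun := by
    refine (isInducing_topologized S.withSeminorms S.gen.toFun).continuous_iff.2 ?_
    exact continuous_id.congr fun x => ((LinearEquiv.ofBijective _ h).apply_symm_apply x).symm

theorem upEquiv_mem_graph (hS : S.Admissible) (x : S.up) :
    (S.upIncl x, upEquiv hS.bijective x) ∈ generatorGraph S.T :=
  have := hS.hausdorff
  generator_mem_generatorGraph S.T x

theorem upIncl_T (hS : S.Admissible) (t : ℝ≥0) (x : S.up) :
    S.upIncl (S.up.T t x) = S.T t (S.upIncl x) := by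
  have := hS.hausdorff
  have hex : ∃ R : Topologized S.domainFamily →L[𝕜] Topologized S.domainFamily,
      ∀ x : S.gen.domain, S.gen.domain.subtype (R x) = S.T t x := by
    -- The restriction is `A⁻¹ T(t) A`, which is continuous for the new seminorms; so the default
    -- `0` in `up` does not occur.
    let e := upEquiv hS.bijective
    refine ⟨((e.symm : S →L[𝕜] S.up).comp (S.T t)).comp (e : S.up →L[𝕜] S), fun x => ?_⟩
    have h1 := hS.semigroup.apply_mem_generatorGraph t (upEquiv_mem_graph hS x)
    have h2 := upEquiv_mem_graph hS (e.symm (S.T t (e x)))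
    rw [e.apply_symm_apply] at h2
    exact ((bijective_generator_iff S.T).1 hS.bijective _).unique h2 h1
  have hT : S.up.T t = hex.choose := dif_pos hex
  rw [hT]
  exact hex.choose_spec x

theorem isStep_up (hS : S.Admissible) : IsStep S.upIncl (upEquiv hS.bijective) where
  mem_graph := upEquiv_mem_graph hS
  map_T t x := by
    have := hS.hausdorff
    have h1 := hS.semigroup.apply_mem_generatorGraph t (upEquiv_mem_graph hS x)
    rw [← upIncl_T hS] at h1
    exact generatorGraph_unique (upEquiv_mem_graph hS _) h1

end Up

/-! ### The step to the completion -/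

section Down

variable {S : Level.{u} 𝕜 Γ}

theorem inverseMap_T (hS : S.Admissible) (t : ℝ≥0) (x : S) :
    inverseMap S.gen (S.T t x) = S.T t (inverseMap S.gen x) :=
  have := hS.hausdorff
  inverseMap_eq hS.bijective
    (hS.semigroup.apply_mem_generatorGraph t (inverseMap_mem_generatorGraph hS.bijective x))

/-- The space itself, as a completion for the seminorms `p (A⁻¹ x)`
along the map `A⁻¹`. -/
def checkCompletion (hS : S.Admissible) : AbstractCompletion.{u} (Topologized S.checkFamily) where
  space := S
  coe := fun x => inverseMap S.gen x
  uniformStruct := inferInstance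
  complete := hS.complete
  separation := have := hS.hausdorff; inferInstance
  isUniformInducing := isUniformInducing_topologized S.withSeminorms (inverseMap S.gen)
  dense := by
    have := hS.hausdorff
    refine denseRange_of_mem_generatorGraph (𝕜 := 𝕜) (T := S.T)
      (fun t (v : S) => ?_) fun y => ⟨y, inverseMap_mem_generatorGraph hS.bijective y⟩
    exact ⟨(((t : ℝ) : 𝕜)⁻¹) • (S.T t v - v), by simp [inverseMap_T hS]⟩

/-- The extension of `A⁻¹` to the completion, as a uniform isomorphism. -/
def downUniformEquiv (hS : S.Admissible) : S.down ≃ᵤ S :=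
  (Completion.cPkg (α := Topologized S.checkFamily)).compareEquiv (checkCompletion hS)

theorem downUniformEquiv_incl (hS : S.Admissible) (x : S) :
    downUniformEquiv hS (S.downIncl x) = inverseMap S.gen x :=
  AbstractCompletion.compare_coe _ (checkCompletion hS) x

theorem denseRange_downIncl : DenseRange S.downIncl :=
  Completion.denseRange_coe (α := Topologized S.checkFamily)

theorem downUniformEquiv_add (hS : S.Admissible) (x y : S.down) :
    downUniformEquiv hS (x + y) = downUniformEquiv hS x + downUniformEquiv hS y := by
  have := hS.hausdorff
  have hc := (downUniformEquiv hS).continuous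
  refine denseRange_downIncl.induction_on₂
    (p := fun x y => downUniformEquiv hS (x + y) =
      downUniformEquiv hS x + downUniformEquiv hS y)
    (isClosed_eq (by fun_prop) (by fun_prop)) (fun a b => ?_) x y
  rw [← map_add, downUniformEquiv_incl, downUniformEquiv_incl, downUniformEquiv_incl, map_add]

theorem downUniformEquiv_smul (hS : S.Admissible) (c : 𝕜) (x : S.down) :
    downUniformEquiv hS (c • x) = c • downUniformEquiv hS x := by
  have := hS.hausdorff
  have hc := (downUniformEquiv hS).continuous
  refine denseRange_downIncl.induction_on
    (p := fun x => downUniformEquiv hS (c • x) = c • downUniformEquiv hS x) x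
    (isClosed_eq (hc.comp (continuous_const_smul c)) (hc.const_smul c)) (fun a => ?_)
  rw [← map_smul, downUniformEquiv_incl, downUniformEquiv_incl, map_smul]

/-- The extension of `A⁻¹` to the completion, as a linear homeomorphism. -/
def downEquiv (hS : S.Admissible) : S.down ≃L[𝕜] S where
  toFun := downUniformEquiv hS
  invFun := (downUniformEquiv hS).symm
  left_inv := (downUniformEquiv hS).left_inv
  right_inv := (downUniformEquiv hS).right_inv
  continuous_toFun := (downUniformEquiv hS).continuous
  continuous_invFun := (downUniformEquiv hS).symm.continuous
  map_add' := downUniformEquiv_add hS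
  map_smul' := downUniformEquiv_smul hS

theorem downEquiv_incl (hS : S.Admissible) (x : S) :
    downEquiv hS (S.downIncl x) = inverseMap S.gen x :=
  downUniformEquiv_incl hS x

theorem down_T_incl (hS : S.Admissible) (t : ℝ≥0) (x : S) :
    S.down.T t (S.downIncl x) = S.downIncl (S.T t x) := by
  have hex : ∃ R : Completion (Topologized S.checkFamily) →L[𝕜]
        Completion (Topologized S.checkFamily),
      ∀ x : Topologized S.checkFamily,
        R (x : Completion (Topologized S.checkFamily)) =
          ((show Topologized S.checkFamily from S.T t x) :
            Completion (Topologized S.checkFamily)) := by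
    -- With `e` extending `A⁻¹`, which commutes with `T t`, the extension is `e⁻¹ T(t) e`; so the
    -- default `0` in `down` does not occur.
    let e := downEquiv hS
    refine ⟨((e.symm : S →L[𝕜] S.down).comp (S.T t)).comp (e : S.down →L[𝕜] S), fun x => ?_⟩
    refine (congrArg (fun z => e.symm (S.T t z)) (downEquiv_incl hS x)).trans ?_
    exact e.symm_apply_eq.2 ((inverseMap_T hS t x).symm.trans (downEquiv_incl hS (S.T t x)).symm)
  have hT : S.down.T t = hex.choose := dif_pos hex
  rw [hT]
  exact hex.choose_spec x

theorem downEquiv_T (hS : S.Admissible) (t : ℝ≥0) (x : S.down) :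
    downEquiv hS (S.down.T t x) = S.T t (downEquiv hS x) := by
  have := hS.hausdorff
  refine denseRange_downIncl.induction_on
    (p := fun x => downEquiv hS (S.down.T t x) = S.T t (downEquiv hS x)) x
    (isClosed_eq ((downEquiv hS).continuous.comp (S.down.T t).continuous)
      ((S.T t).continuous.comp (downEquiv hS).continuous)) fun a => ?_
  rw [down_T_incl hS, downEquiv_incl, downEquiv_incl, inverseMap_T hS]

theorem admissible_down (hS : S.Admissible) : S.down.Admissible :=
  hS.of_equiv (downEquiv hS) (downEquiv_T hS)

/-- The inverse of the extended `A⁻¹` carries the graph pair `(A⁻¹ x, x)` of the old generator to a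
pair for the new one, and sends `A⁻¹ x` back to the included `x`. -/
theorem isStep_down (hS : S.Admissible) : IsStep S.downIncl (downEquiv hS).symm where
  map_T t x := by
    rw [(downEquiv hS).symm_apply_eq, downEquiv_T hS, (downEquiv hS).apply_symm_apply]
  mem_graph x := by
    have := hS.hausdorff
    have h := map_mem_generatorGraph (f := (downEquiv hS).symm.toLinearEquiv.toLinearMap)
      (T' := S.down.T) (downEquiv hS).symm.continuous
      (fun t x => (downEquiv hS).injective (by simp [downEquiv_T hS]))
      (inverseMap_mem_generatorGraph hS.bijective x)
    have hx : (downEquiv hS).symm (inverseMap S.gen x) = S.downIncl x :=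
      (downEquiv hS).symm_apply_eq.2 (downEquiv_incl hS x).symm
    rw [← hx]
    exact h

end Down

/-! ### The tower over all integers -/

section Tower

variable {S : Level.{u} 𝕜 Γ}

theorem admissible_upper (hS : S.Admissible) : ∀ n : ℕ, (S.upper n).Admissible
  | 0 => hS
  | n + 1 => (isStep_up (admissible_upper hS n)).admissible (admissible_upper hS n)

theorem admissible_lower (hS : S.Admissible) : ∀ n : ℕ, (S.lower n).Admissible
  | 0 => hS
  | n + 1 => admissible_down (admissible_lower hS n)

theorem admissible_tower (hS : S.Admissible) : ∀ n : ℤ, (S.tower n).Admissible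
  | Int.ofNat n => admissible_upper hS n
  | Int.negSucc n => admissible_lower hS (n + 1)

/-- The generators of the tower, as linear homeomorphisms. -/
def towerEquiv (hS : S.Admissible) : (n : ℤ) → (S.tower (n + 1) ≃L[𝕜] S.tower n)
  | Int.ofNat n => upEquiv (admissible_upper hS n).bijective
  -- The index `n + 1` reduces to different constructors of `ℤ` for `n = -1` and `n ≤ -2`, so these
  -- cases are separate.
  | Int.negSucc 0 => (downEquiv (admissible_lower hS 0)).symm
  | Int.negSucc (n + 1) => (downEquiv (admissible_lower hS (n + 1))).symm

theorem isStep_tower (hS : S.Admissible) : ∀ n : ℤ, IsStep (S.incl n) (towerEquiv hS n)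
  | Int.ofNat n => isStep_up (admissible_upper hS n)
  | Int.negSucc 0 => isStep_down (admissible_lower hS 0)
  | Int.negSucc (n + 1) => isStep_down (admissible_lower hS (n + 1))

/-- For `n ≥ 0` the seminorms on `X (n + 1)` are by definition those of `X n` composed with the
generator. -/
theorem tower_p_apply (hS : S.Admissible) :
    ∀ n : ℤ, 0 ≤ n → ∀ i x, (S.tower (n + 1)).p i x = (S.tower n).p i (towerEquiv hS n x)
  | Int.ofNat _, _, _, _ => rfl

end Tower

end Level

end SobolevTower

end


open SobolevTower in
theorem theorem1 {𝕜 : Type*} [RCLike 𝕜] {Γ : Type*} {E : Type*} [AddCommGroup E] [Module 𝕜 E]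
    [UniformSpace E] [IsUniformAddGroup E] [ContinuousSMul 𝕜 E] [CompleteSpace E] [T2Space E]
    (p : SeminormFamily 𝕜 E Γ) (hp : WithSeminorms p)
    (T : ℝ≥0 → E →L[𝕜] E) (hT : IsExpEquicontinuousSemigroup T)
    (hbij : Function.Bijective (generator T).toFun)
    (hinv : Continuous (inverseMap (generator T))) :
    let X : ℤ → Level 𝕜 Γ := (Level.mk E p hp T).tower
    let ι : (n : ℤ) → (X (n + 1) →ₗ[𝕜] X n) := (Level.mk E p hp T).incl
    -- the spaces are complete Hausdorff locally convex spaces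
    (∀ n : ℤ, CompleteSpace (X n) ∧ T2Space (X n) ∧ WithSeminorms (X n).p) ∧
    -- dense and continuous inclusions
    (∀ n : ℤ, Function.Injective (ι n) ∧ DenseRange (ι n) ∧ Continuous (ι n)) ∧
    -- the operators form semigroups of the same kind
    (∀ n : ℤ, IsExpEquicontinuousSemigroup (X n).T) ∧
    -- the generators have continuous inverses, so that the next step can be carried out
    (∀ n : ℤ, Function.Bijective (X n).gen.toFun ∧ Continuous (inverseMap (X n).gen)) ∧
    -- restriction, and unique continuous extension, of the operators
    (∀ (n : ℤ) (t : ℝ≥0),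
      (∀ x : X (n + 1), ι n ((X (n + 1)).T t x) = (X n).T t (ι n x)) ∧
      (∀ f : X n → X n, Continuous f →
        (∀ x : X (n + 1), f (ι n x) = ι n ((X (n + 1)).T t x)) → f = (X n).T t)) ∧
    -- the generators as isomorphisms
    ∃ A : (n : ℤ) → (X (n + 1) ≃L[𝕜] X n),
      (∀ n : ℤ, (X n).gen.domain = LinearMap.range (ι n) ∧
        ∀ x : X (n + 1), (ι n x, A n x) ∈ (X n).gen.graph) ∧
      -- restriction, and unique continuous extension, of the generators
      (∀ n : ℤ,
        (∀ x : X (n + 1 + 1), ι n (A (n + 1) x) = A n (ι (n + 1) x)) ∧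
        (∀ f : X (n + 1) → X n, Continuous f →
          (∀ x : X (n + 1 + 1), f (ι (n + 1) x) = ι n (A (n + 1) x)) → f = A n)) ∧
      -- for `n + 1 ≤ 0` the topology of `X (n + 1)` is given by the seminorms `p n ∘ A n`
      (∀ n : ℤ, n + 1 ≤ 0 →
        WithSeminorms (fun γ : Γ => ((X n).p γ).comp (A n : X (n + 1) →ₗ[𝕜] X n))) ∧
      -- for `0 ≤ n` the space `X n` is the completion of `X (n + 1)` for the weaker topology
      (∀ n : ℤ, 0 ≤ n →
        IsCompletionMap (fun x : Topologized (X (n + 1)).checkFamily => ι n x)) := by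
  intro X ι
  have hS : (Level.mk E p hp T).Admissible :=
    ⟨inferInstance, inferInstance, hT, hbij, hinv⟩
  have hX : ∀ n, (X n).Admissible := Level.admissible_tower hS
  have hA : ∀ n, Level.IsStep (ι n) (Level.towerEquiv hS n) := Level.isStep_tower hS
  refine ⟨fun n => ⟨(hX n).complete, (hX n).hausdorff, (X n).withSeminorms⟩,
    fun n => ⟨(hA n).injective (hX n), (hA n).denseRange (hX n), (hA n).continuous (hX n)⟩,
    fun n => (hX n).semigroup, fun n => ⟨(hX n).bijective, (hX n).continuous_inverse⟩,
    fun n t => ⟨(hA n).map_incl (hX n) t, fun f hf h => ?_⟩,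
    Level.towerEquiv hS, fun n => ⟨(hA n).domain_eq (hX n), fun x => ?_⟩,
    fun n => ⟨(hA n).incl_apply (hX n) (hA (n + 1)), fun f hf h => ?_⟩, fun n _ => ?_,
    fun n hn => (hA n).isCompletionMap (hX n) (Level.tower_p_apply hS n hn)⟩
  · have := (hX n).hausdorff
    refine ((hA n).denseRange (hX n)).equalizer hf ((X n).T t).continuous (funext fun x => ?_)
    exact (h x).trans ((hA n).map_incl (hX n) t x)
  · have := (hX n).hausdorff
    have h := (hA n).mem_graph x
    rwa [← generator_graph] at h
  · have := (hX n).hausdorff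
    refine ((hA (n + 1)).denseRange (hX (n + 1))).equalizer hf
      (Level.towerEquiv hS n).continuous (funext fun x => ?_)
    exact (h x).trans ((hA n).incl_apply (hX n) (hA (n + 1)) x)
  -- A homeomorphism is inducing, so pulling back the seminorms of `X n` along `A n` yields the
  -- topology of `X (n + 1)`.
  · exact (Level.towerEquiv hS n).toHomeomorph.isInducing.withSeminorms
      (f := ((Level.towerEquiv hS n : X (n + 1) →L[𝕜] X n) : X (n + 1) →ₗ[𝕜] X n))
      (X n).withSeminorms
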